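/- Let $\mathbb{H}=\{z\in\mathbb{C}:\operatorname{Im}z>0\}$ and $\mathbb{D}=\{z\in\mathbb{C}:|z|<1\}$. For a self-map $\phi$ of a set $X$, with $n$-th iterate $\phi_n$ ($n\ge 0$, $\phi_0=\mathrm{id}$), two points $z,w\in X$ belong to the same grand orbit if $\phi_n(z)=\phi_k(w)$ for some integers $n,k\ge 0$; this is an equivalence relation, and $\mathcal{G}(\phi)$ denotes the set of its classes, the grand orbits. If $\sigma:X\to Y$ satisfies $\sigma\circ\phi=\tau\circ\sigma$, where $\tau$ is a self-map of $Y$, then $\sigma$ induces a map $\Sigma:\mathcal{G}(\phi)\to\mathcal{G}(\tau)$; the solution $\sigma$ is called canonical if $\Sigma$ is a bijection. Up to conjugation, the hyperbolic automorphisms are the dilations $z\mapsto Sz$ of $\mathbb{H}$ with $S>1$, the parabolic ones are the translations $z\mapsto z+1$ and $z\mapsto z-1$ of $\mathbb{H}$, and the elliptic ones (including the identity) are the rotations $w\mapsto e^{i\theta}w$ of $\mathbb{D}$ with $\theta\in[0,2\pi)$. For $S,T>1$, $\varepsilon,\varepsilon'\in\{1,-1\}$ and $\theta\in[0,2\pi)$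 consider the following sets of analytic maps: - $\mathcal{A}_{h\to h}(S,T)=\{\sigma:\mathbb{H}\to\mathbb{H}\mid \sigma(Sz)=T\sigma(z)\}$; - $\mathcal{A}_{h\to p}(S,\varepsilon)=\{\sigma:\mathbb{H}\to\mathbb{H}\mid \sigma(Sz)=\sigma(z)+\varepsilon\}$; - $\mathcal{A}_{h\to e}(S,\theta)=\{\sigma:\mathbb{H}\to\mathbb{D}\mid \sigma(Sz)=e^{i\theta}\sigma(z)\}$; - $\mathcal{A}_{p\to p}(\varepsilon,\varepsilon')=\{\sigma:\mathbb{H}\to\mathbb{H}\mid \sigma(z+\varepsilon)=\sigma(z)+\varepsilon'\}$; - $\mathcal{A}_{p\to h}(\varepsilon,T)=\{\sigma:\mathbb{H}\to\mathbb{H}\mid \sigma(z+\varepsilon)=T\sigma(z)\}$; - $\mathcal{A}_{p\to e}(\varepsilon,\theta)=\{\sigma:\mathbb{H}\to\mathbb{D}\mid \sigma(z+\varepsilon)=e^{i\theta}\sigma(z)\}$. **Theorem.** The only canonical solutions arising in these sets are the following. 1. For every $S>1$, $\mathcal{A}_{h\to h}(S,S)=\{z\mapsto cz\mid c>0\}$.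 A map $\sigma\in\mathcal{A}_{h\to h}(S,T)$ is canonical if and only if $S=T$ and $\sigma(z)=cz$ for some $c>0$. 2. For each $\varepsilon\in\{1,-1\}$, $\{z\mapsto z+d\mid d\in\mathbb{R}\}$ is a proper subset of $\mathcal{A}_{p\to p}(\varepsilon,\varepsilon)$. A map $\sigma\in\mathcal{A}_{p\to p}(\varepsilon,\varepsilon')$ is canonical if and only if $\varepsilon=\varepsilon'$ and $\sigma(z)=z+d$ for some $d\in\mathbb{R}$. 3. None of the sets $\mathcal{A}_{h\to p}(S,\varepsilon)$, $\mathcal{A}_{p\to h}(\varepsilon,T)$, $\mathcal{A}_{h\to e}(S,\theta)$, $\mathcal{A}_{p\to e}(\varepsilon,\theta)$ contains a canonical solution. -/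

import Mathlib

open scoped UpperHalfPlane Complex.UnitDisc

namespace GrandOrbits

/-- The grand orbit generated by `z` under the self-map `φ`: all points `w` one of whose
iterates `φ^[n] w` is a point `φ^[k] z` of the forward orbit of `z`. -/
def grandOrbit {X : Type*} (φ : X → X) (z : X) : Set X :=
  ⋃ k : ℕ, ⋃ n : ℕ, φ^[n] ⁻¹' {φ^[k] z}

theorem mem_grandOrbit {X : Type*} {φ : X → X} {z w : X} :
    w ∈ grandOrbit φ z ↔ ∃ k n : ℕ, φ^[n] w = φ^[k] z := by
  simp [grandOrbit]

/-- The equivalence relation of lying in a common grand orbit. -/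
def grandOrbitSetoid {X : Type*} (φ : X → X) : Setoid X where
  r w z := w ∈ grandOrbit φ z
  iseqv :=
    { refl := fun _ => mem_grandOrbit.2 ⟨0, 0, rfl⟩
      symm := fun h => by
        obtain ⟨k, n, h⟩ := mem_grandOrbit.1 h
        exact mem_grandOrbit.2 ⟨n, k, h.symm⟩
      trans := fun {x y z} hxy hyz => by
        obtain ⟨k, n, h⟩ := mem_grandOrbit.1 hxy
        obtain ⟨l, m, h'⟩ := mem_grandOrbit.1 hyz
        refine mem_grandOrbit.2 ⟨k + l, m + n, ?_⟩
        rw [Function.iterate_add_apply, h, ← Function.iterate_add_apply, Nat.add_comm m k,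
          Function.iterate_add_apply, h', ← Function.iterate_add_apply] }

/-- The set `𝒢(φ)` of all grand orbits of the self-map `φ`. -/
def GrandOrbitSpace {X : Type*} (φ : X → X) : Type _ :=
  Quotient (grandOrbitSetoid φ)

/-- The map `Σ : 𝒢(φ) → 𝒢(τ)` induced by a semiconjugation `σ ∘ φ = τ ∘ σ`. -/
def inducedMap {X Y : Type*} {φ : X → X} {τ : Y → Y} (σ : X → Y)
    (h : Function.Semiconj σ φ τ) : GrandOrbitSpace φ → GrandOrbitSpace τ :=
  Quotient.map σ fun w z hwz => by
    obtain ⟨k, n, e⟩ := mem_grandOrbit.1 hwz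
    refine mem_grandOrbit.2 ⟨k, n, ?_⟩
    rw [← (h.iterate_right n).eq, e, (h.iterate_right k).eq]

/-- `σ` is a canonical solution of `σ ∘ φ = τ ∘ σ`: the equation holds and the induced map
between the sets of grand orbits is a bijection. -/
def IsCanonical {X Y : Type*} (φ : X → X) (τ : Y → Y) (σ : X → Y) : Prop :=
  ∃ h : Function.Semiconj σ φ τ, Function.Bijective (inducedMap σ h)

/-- A complex-valued function on the upper half-plane is analytic. -/
def IsAnalytic (f : ℍ → ℂ) : Prop :=
  AnalyticOnNhd ℂ (fun w : ℂ => f (UpperHalfPlane.ofComplex w)) {w : ℂ | 0 < w.im}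

/-- The analytic maps `σ : ℍ → ℍ` with `σ ∘ γ = τ ∘ σ`. -/
def halfPlaneSolutions (γ τ : ℍ → ℍ) : Set (ℍ → ℍ) :=
  {σ | IsAnalytic (fun z => (σ z : ℂ)) ∧ Function.Semiconj σ γ τ}

/-- The analytic maps `σ : ℍ → 𝔻` with `σ ∘ γ = τ ∘ σ`. -/
def discSolutions (γ : ℍ → ℍ) (τ : 𝔻 → 𝔻) : Set (ℍ → 𝔻) :=
  {σ | IsAnalytic (fun z => (σ z : ℂ)) ∧ Function.Semiconj σ γ τ}

/-- The dilation `z ↦ c z` of `ℍ`, for `c > 0`. -/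
noncomputable def dilation (c : {x : ℝ // 0 < x}) : ℍ → ℍ := fun z => c • z

/-- The translation `z ↦ z + d` of `ℍ`, for `d` real. -/
noncomputable def translation (d : ℝ) : ℍ → ℍ := fun z => d +ᵥ z

/-- The unit translation `z ↦ z + 1` or `z ↦ z - 1` of `ℍ`. -/
noncomputable def unitTranslation (ε : ℤˣ) : ℍ → ℍ := translation ((ε : ℤ) : ℝ)

/-- The rotation `w ↦ exp (i θ) w` of `𝔻`. -/
noncomputable def discRotation (θ : ℝ) : 𝔻 → 𝔻 := fun w => Circle.exp θ • w

end GrandOrbits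

namespace GrandOrbits

open Filter Topology Set ComplexConjugate

/-! When the target automorphism has no periodic points, a canonical `σ` is bijective
(`IsCanonical.surjective`, `IsCanonical.injective`). Its inverse is then holomorphic too, so
Schwarz–Pick makes `σ` a hyperbolic isometry (`dist_eq_dist_of_bijective`), and it carries the
displacement dist(z, φ z) of the source to that of the target. For z ↦ Sz with S > 1 the
displacement has a positive minimum, attained exactly on the imaginary axis, and this minimum
determines S. For z ↦ z + d with d ≠ 0 it depends only on Im z and tends to 0 as Im z → ∞. Hence the
two types never match, two dilations match only if S = T, and between unit translations `σ`
preserves Im z, so σ(z) - z is a real constant. Commuting with a dilation is rigid without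
bijectivity, by the equality case of the Schwarz lemma. A rotation fixes 0, so for elliptic targets
the obstruction is topological (`not_isCanonical_disc`): an invariant function of the form exp(2πiL)
would descend to the simply connected disc and acquire an invariant logarithm there. -/

/-! ### Cayley charts and the Schwarz–Pick lemma -/

theorem norm_cayley_eq_tanh (z a : ℍ) :
    ‖((z : ℂ) - a) / (z - conj (a : ℂ))‖ = Real.tanh (dist z a / 2) := by
  rw [UpperHalfPlane.tanh_half_dist, norm_div, Complex.dist_eq, Complex.dist_eq]

theorem coe_sub_conj_ne_zero (z a : ℍ) : (z : ℂ) - conj (a : ℂ) ≠ 0 := by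
  intro h
  have := congrArg Complex.im h
  have h1 := z.im_pos
  have h2 := a.im_pos
  simp at this
  linarith

theorem norm_cayley_lt_one (z a : ℍ) : ‖((z : ℂ) - a) / (z - conj (a : ℂ))‖ < 1 := by
  rw [norm_cayley_eq_tanh]
  exact Real.tanh_lt_one _

/-- The Cayley transform of `ℍ` onto the unit disc centred at `a` is injective. -/
theorem cayley_injective (a : ℍ) {z w : ℍ}
    (h : ((z : ℂ) - a) / (z - conj (a : ℂ)) = (w - a) / (w - conj (a : ℂ))) : z = w := by
  rw [div_eq_div_iff (coe_sub_conj_ne_zero _ _) (coe_sub_conj_ne_zero _ _)] at h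
  have h3 : ((z : ℂ) - w) * (a - conj (a : ℂ)) = 0 := by linear_combination h
  rcases mul_eq_zero.1 h3 with h3 | h3
  · exact UpperHalfPlane.coe_injective (sub_eq_zero.1 h3)
  · exact absurd h3 (coe_sub_conj_ne_zero a a)

/-- The inverse Cayley transform maps the unit disc into the upper half-plane. -/
theorem im_cayley_symm_pos (a : ℍ) {ζ : ℂ} (hζ : ‖ζ‖ < 1) :
    0 < ((a - conj (a : ℂ) * ζ) / (1 - ζ)).im := by
  have hne : 1 - ζ ≠ 0 := by
    intro h
    rw [← sub_eq_zero.1 h] at hζ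
    simp at hζ
  have hN : 0 < Complex.normSq (1 - ζ) := Complex.normSq_pos.2 hne
  have h1 : Complex.normSq ζ < 1 := by
    rw [Complex.normSq_eq_norm_sq]
    nlinarith [norm_nonneg ζ]
  have : ((a - conj (a : ℂ) * ζ) / (1 - ζ)).im
      = a.im * (1 - Complex.normSq ζ) / Complex.normSq (1 - ζ) := by
    rw [Complex.div_im, ← sub_div]
    congr 1
    simp [Complex.normSq_apply]
    ring
  rw [this]
  exact div_pos (mul_pos a.im_pos (by linarith)) hN

theorem cayley_symm_cayley (a z : ℍ) :
    (a - conj (a : ℂ) * (((z : ℂ) - a) / (z - conj (a : ℂ)))) /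
      (1 - ((z : ℂ) - a) / (z - conj (a : ℂ))) = z := by
  have h1 := coe_sub_conj_ne_zero z a
  have h2 := coe_sub_conj_ne_zero a a
  have h3 : 1 - ((z : ℂ) - a) / (z - conj (a : ℂ)) ≠ 0 := by
    rw [one_sub_div h1, sub_sub_sub_cancel_left]
    exact div_ne_zero h2 h1
  rw [div_eq_iff h3]
  field_simp
  ring

/-- The map `σ` of the half-plane, read in the Cayley charts centred at `a` and `σ a`. -/
noncomputable def discChart (σ : ℍ → ℍ) (a : ℍ) (ζ : ℂ) : ℂ :=
  ((σ (UpperHalfPlane.ofComplex ((a - conj (a : ℂ) * ζ) / (1 - ζ))) : ℂ) - σ a) /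
    (σ (UpperHalfPlane.ofComplex ((a - conj (a : ℂ) * ζ) / (1 - ζ))) - conj (σ a : ℂ))

theorem discChart_cayley (σ : ℍ → ℍ) (a z : ℍ) :
    discChart σ a (((z : ℂ) - a) / (z - conj (a : ℂ))) =
      ((σ z : ℂ) - σ a) / (σ z - conj (σ a : ℂ)) := by
  rw [discChart, cayley_symm_cayley, UpperHalfPlane.ofComplex_apply]

theorem discChart_zero (σ : ℍ → ℍ) (a : ℍ) : discChart σ a 0 = 0 := by
  simp [discChart]

theorem mapsTo_discChart (σ : ℍ → ℍ) (a : ℍ) :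
    MapsTo (discChart σ a) (Metric.ball 0 1) (Metric.closedBall 0 1) := fun ζ _ => by
  rw [mem_closedBall_zero_iff]
  exact (norm_cayley_lt_one _ _).le

theorem differentiableOn_discChart {σ : ℍ → ℍ} (hσ : IsAnalytic fun z => (σ z : ℂ)) (a : ℍ) :
    DifferentiableOn ℂ (discChart σ a) (Metric.ball 0 1) := by
  intro ζ hζ
  rw [mem_ball_zero_iff] at hζ
  have hne : 1 - ζ ≠ 0 := by
    intro h
    rw [← sub_eq_zero.1 h] at hζ
    simp at hζ
  have h1 : DifferentiableAt ℂ (fun ζ : ℂ => (a - conj (a : ℂ) * ζ) / (1 - ζ)) ζ :=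
    DifferentiableAt.div (by fun_prop) (by fun_prop) hne
  have h2 := ((hσ _ (im_cayley_symm_pos a hζ)).differentiableAt).comp ζ h1
  exact (DifferentiableAt.div (h2.sub_const _) (h2.sub_const _)
    (coe_sub_conj_ne_zero _ _)).differentiableWithinAt

/-- **Schwarz–Pick lemma**: a holomorphic self-map of the upper half-plane does not increase
hyperbolic distances. -/
theorem dist_le_dist_of_isAnalytic {σ : ℍ → ℍ} (hσ : IsAnalytic fun z => (σ z : ℂ)) (z a : ℍ) :
    dist (σ z) (σ a) ≤ dist z a := by
  have h := Complex.norm_le_norm_of_mapsTo_ball (differentiableOn_discChart hσ a)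
    (mapsTo_discChart σ a) (discChart_zero σ a) (norm_cayley_lt_one z a)
  rw [discChart_cayley, norm_cayley_eq_tanh, norm_cayley_eq_tanh] at h
  -- Monotonicity of tanh: after clearing denominators, tanh A ≤ tanh B reads sinh (A - B) ≤ 0.
  rw [Real.tanh_eq_sinh_div_cosh, Real.tanh_eq_sinh_div_cosh,
    div_le_div_iff₀ (Real.cosh_pos _) (Real.cosh_pos _)] at h
  have h0 : Real.sinh (dist (σ z) (σ a) / 2 - dist z a / 2) ≤ 0 := by
    rw [Real.sinh_sub]
    linarith
  linarith [Real.sinh_nonpos_iff.1 h0]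

/-- A holomorphic self-map of the upper half-plane with two fixed points is the identity. -/
theorem eq_self_of_two_fixed_points {σ : ℍ → ℍ} (hσ : IsAnalytic fun z => (σ z : ℂ)) {a b : ℍ}
    (hab : a ≠ b) (ha : σ a = a) (hb : σ b = b) (z : ℍ) : σ z = z := by
  set ζ := ((b : ℂ) - a) / (b - conj (a : ℂ)) with hζ
  have hζ0 : ζ ≠ 0 := div_ne_zero
    (sub_ne_zero.2 fun h => hab (UpperHalfPlane.coe_injective h.symm)) (coe_sub_conj_ne_zero _ _)
  have hfix : discChart σ a ζ = ζ := by rw [hζ, discChart_cayley, ha, hb]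
  have hslope : dslope (discChart σ a) 0 ζ = 1 := by
    rw [dslope_of_ne _ hζ0, slope_def_field, hfix, discChart_zero, sub_zero, div_self hζ0]
  -- Equality case of the Schwarz lemma: the second fixed point gives slope 1, so the chart map is
  -- the identity.
  have key := Complex.affine_of_mapsTo_ball_of_norm_dslope_eq_div
    (R₂ := 1) (differentiableOn_discChart hσ a)
    (by rw [discChart_zero]; exact mapsTo_discChart σ a)
    (mem_ball_zero_iff.2 (norm_cayley_lt_one b a)) (by rw [← hζ, hslope]; simp)
  have hz := key (mem_ball_zero_iff.2 (norm_cayley_lt_one z a))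
  rw [← hζ, hslope] at hz
  simp only [discChart_cayley, discChart_zero, ha, smul_eq_mul, mul_one, sub_zero, zero_add] at hz
  exact cayley_injective a hz

/-! ### Open mapping and holomorphic inverses -/

theorem isPreconnected_im_pos : IsPreconnected {w : ℂ | 0 < w.im} :=
  (convex_halfSpace_im_gt 0).isPreconnected

theorem isOpen_im_pos : IsOpen {w : ℂ | 0 < w.im} :=
  isOpen_lt continuous_const Complex.continuous_im

theorem IsAnalytic.continuous {f : ℍ → ℂ} (hf : IsAnalytic f) : Continuous f := by
  have h := hf.continuousOn.comp_continuous UpperHalfPlane.continuous_coe fun z => z.im_pos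
  simpa [Function.comp_def] using h

theorem IsAnalytic.isOpenMap {f : ℍ → ℂ} (hf : IsAnalytic f) {a b : ℍ} (hab : f a ≠ f b) :
    IsOpenMap f := by
  rcases AnalyticOnNhd.is_constant_or_isOpen hf isPreconnected_im_pos with ⟨w, hw⟩ | h
  · have h1 := hw a a.im_pos
    have h2 := hw b b.im_pos
    simp only [UpperHalfPlane.ofComplex_apply] at h1 h2
    exact absurd (h1.trans h2.symm) hab
  · intro s hs
    have := h (UpperHalfPlane.coe '' s) (by rintro _ ⟨z, -, rfl⟩; exact z.im_pos)
      (UpperHalfPlane.isOpenEmbedding_coe.isOpenMap s hs)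
    simpa [image_image] using this

theorem isAnalytic_of_eqOn {f : ℍ → ℂ} {g : ℂ → ℂ} (hg : AnalyticOnNhd ℂ g {w : ℂ | 0 < w.im})
    (h : ∀ z : ℍ, f z = g z) : IsAnalytic f :=
  hg.congr isOpen_im_pos fun w hw => by
    simp only [h, UpperHalfPlane.ofComplex_apply_of_im_pos hw]

/-- The inverse of a holomorphic bijection of the upper half-plane is holomorphic. -/
theorem isAnalytic_inverse {σ τ : ℍ → ℍ} (hσ : IsAnalytic fun z => (σ z : ℂ))
    (hl : Function.LeftInverse τ σ) (hr : Function.RightInverse τ σ) :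
    IsAnalytic fun z => (τ z : ℂ) := by
  set F : ℂ → ℂ := fun w => σ (UpperHalfPlane.ofComplex w) with hF
  set G : ℂ → ℂ := fun w => τ (UpperHalfPlane.ofComplex w) with hG
  have hτcont : Continuous τ := by
    have hne : (σ UpperHalfPlane.I : ℂ) ≠ σ ((1 : ℝ) +ᵥ UpperHalfPlane.I) := fun h => by
      have := hl.injective (UpperHalfPlane.coe_injective h)
      have := congrArg UpperHalfPlane.re this
      simp at this
    have hopen : IsOpenMap σ := fun s hs => by
      have h := (hσ.isOpenMap hne s hs).preimage UpperHalfPlane.continuous_coe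
      convert h using 1
      ext z
      simp
    refine continuous_def.2 fun s hs => ?_
    rw [← image_eq_preimage_of_inverse hl hr]
    exact hopen s hs
  have hGc : ContinuousOn G {w : ℂ | 0 < w.im} :=
    (UpperHalfPlane.continuous_coe.comp hτcont).comp_continuousOn fun w hw =>
      (UpperHalfPlane.contMDiffAt_ofComplex (n := 0) hw).continuousAt.continuousWithinAt
  have hGim (w : ℂ) : 0 < (G w).im := UpperHalfPlane.im_pos _
  have hFG {w : ℂ} (hw : 0 < w.im) : F (G w) = w := by
    simp only [hF, hG, UpperHalfPlane.ofComplex_apply, hr _,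
      UpperHalfPlane.ofComplex_apply_of_im_pos hw]
  have hFinj : InjOn F {w : ℂ | 0 < w.im} := fun u hu v hv huv => by
    have h := hl.injective (UpperHalfPlane.coe_injective huv)
    rw [UpperHalfPlane.ofComplex_apply_of_im_pos hu,
      UpperHalfPlane.ofComplex_apply_of_im_pos hv] at h
    exact congrArg UpperHalfPlane.coe h
  intro w₀ hw₀
  have hcont : ContinuousAt G w₀ := hGc.continuousAt (isOpen_im_pos.mem_nhds hw₀)
  -- Critical points of `F` are isolated, since otherwise `F` would be locally constant and not
  -- injective. So `G` is differentiable near `w₀` except perhaps at `w₀`, where continuity removes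
  -- the singularity.
  refine Complex.analyticAt_of_differentiable_on_punctured_nhds_of_continuousAt ?_ hcont
  have hderiv : ∀ᶠ z in 𝓝[≠] (G w₀), deriv F z ≠ 0 := by
    refine (hσ _ (hGim w₀)).deriv.eventually_eq_zero_or_eventually_ne_zero.resolve_left
      fun h0 => ?_
    have h0' : ∀ᶠ z in 𝓝 (G w₀), deriv F z = 0 ∧ 0 < z.im :=
      h0.and (isOpen_im_pos.mem_nhds (hGim w₀))
    obtain ⟨r, hr0, hball⟩ := Metric.eventually_nhds_iff_ball.1 h0'
    have hconst : ∀ {u v : ℂ}, u ∈ Metric.ball (G w₀) r → v ∈ Metric.ball (G w₀) r → F u = F v :=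
      Metric.isOpen_ball.is_const_of_deriv_eq_zero
      (convex_ball (G w₀) r).isPreconnected
      (fun z hz => (hσ z (hball z hz).2).differentiableAt.differentiableWithinAt)
      (fun z hz => (hball z hz).1)
    have hmem : G w₀ + (r / 2 : ℝ) ∈ Metric.ball (G w₀) r := by
      rw [mem_ball_iff_norm, add_sub_cancel_left, Complex.norm_real, Real.norm_eq_abs,
        abs_of_pos (by linarith)]
      linarith
    have := hFinj (hball _ hmem).2 (hGim w₀) (hconst hmem (Metric.mem_ball_self hr0))
    rw [add_eq_left, Complex.ofReal_eq_zero] at this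
    linarith
  have htends : Tendsto G (𝓝[≠] w₀) (𝓝[≠] (G w₀)) := by
    refine tendsto_nhdsWithin_iff.2 ⟨hcont.mono_left nhdsWithin_le_nhds, ?_⟩
    filter_upwards [self_mem_nhdsWithin, mem_nhdsWithin_of_mem_nhds (isOpen_im_pos.mem_nhds hw₀)]
      with w hne hw heq
    refine hne ?_
    rw [mem_singleton_iff, ← hFG hw, heq, hFG hw₀]
  filter_upwards [htends.eventually hderiv,
    mem_nhdsWithin_of_mem_nhds (isOpen_im_pos.mem_nhds hw₀)] with w hw hwim
  exact (HasDerivAt.of_local_left_inverse (hGc.continuousAt (isOpen_im_pos.mem_nhds hwim))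
    (hσ _ (hGim w)).differentiableAt.hasDerivAt hw
    (by filter_upwards [isOpen_im_pos.mem_nhds hwim] with v hv using hFG hv)).differentiableAt

/-- Schwarz–Pick applies both to `σ` and to its inverse. -/
theorem dist_eq_dist_of_bijective {σ : ℍ → ℍ} (hσ : IsAnalytic fun z => (σ z : ℂ))
    (hbij : Function.Bijective σ) (z w : ℍ) : dist (σ z) (σ w) = dist z w := by
  obtain ⟨τ, hl, hr⟩ := Function.bijective_iff_has_inverse.1 hbij
  refine le_antisymm (dist_le_dist_of_isAnalytic hσ z w) ?_
  simpa only [hl _] using dist_le_dist_of_isAnalytic (isAnalytic_inverse hσ hl hr) (σ z) (σ w)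

/-! ### From canonical to bijective -/

section Canonical

variable {X Y : Type*} {φ : X → X} {τ : Y → Y} {σ : X → Y}

/-- Surjectivity on orbits gives σ(φⁿ z) = τᵏ y. Pulling φⁿ z back k times under `φ` and cancelling
τᵏ yields a preimage of y itself. -/
theorem IsCanonical.surjective (h : IsCanonical φ τ σ) (hφ : Function.Surjective φ)
    (hτ : Function.Injective τ) : Function.Surjective σ := fun y => by
  obtain ⟨hs, -, hsurj⟩ := h
  obtain ⟨q, hq⟩ := hsurj (Quotient.mk (grandOrbitSetoid τ) y)
  obtain ⟨z, rfl⟩ := Quotient.exists_rep q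
  obtain ⟨k, n, e⟩ := mem_grandOrbit.1 (Quotient.exact hq)
  obtain ⟨v, hv⟩ := hφ.iterate k (φ^[n] z)
  rw [← (hs.iterate_right n).eq, ← hv, (hs.iterate_right k).eq] at e
  exact ⟨v, hτ.iterate k e⟩

theorem IsCanonical.exists_iterate_eq (h : IsCanonical φ τ σ) {w z : X} (hwz : σ w = σ z) :
    ∃ k n : ℕ, φ^[n] w = φ^[k] z := by
  obtain ⟨hs, hinj, -⟩ := h
  refine mem_grandOrbit.1 (Quotient.exact
    (hinj (a₁ := Quotient.mk (grandOrbitSetoid φ) w) (a₂ := Quotient.mk (grandOrbitSetoid φ) z) ?_))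
  exact congrArg (Quotient.mk (grandOrbitSetoid τ)) hwz

/-- A relation φⁿ w = φᵏ z inside a fibre of `σ` projects to τⁿ y = τᵏ y. Without periodic points n
= k, and φⁿ cancels. -/
theorem IsCanonical.injective (h : IsCanonical φ τ σ) (hφ : Function.Injective φ)
    (hτ : ∀ y n k, τ^[n] y = τ^[k] y → n = k) : Function.Injective σ := fun w z hwz => by
  obtain ⟨k, n, e⟩ := h.exists_iterate_eq hwz
  obtain ⟨hs, -⟩ := h
  have h1 := congrArg σ e
  rw [(hs.iterate_right n).eq, (hs.iterate_right k).eq, hwz] at h1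
  obtain rfl := hτ _ _ _ h1
  exact hφ.iterate n e

theorem isCanonical_of_bijective (hs : Function.Semiconj σ φ τ) (hσ : Function.Bijective σ) :
    IsCanonical φ τ σ := by
  refine ⟨hs, ?_, ?_⟩
  · rintro ⟨w⟩ ⟨z⟩ h
    obtain ⟨k, n, e⟩ := mem_grandOrbit.1 (Quotient.exact h)
    rw [← (hs.iterate_right n).eq, ← (hs.iterate_right k).eq] at e
    exact Quotient.sound (mem_grandOrbit.2 ⟨k, n, hσ.1 e⟩)
  · rintro ⟨y⟩
    obtain ⟨z, rfl⟩ := hσ.2 y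
    exact ⟨Quotient.mk _ z, rfl⟩

end Canonical

/-! ### The topological obstruction for elliptic targets -/

theorem apply_iterate_of_add_one {X : Type*} {φ : X → X} {L : X → ℂ}
    (hL : ∀ z, L (φ z) = L z + 1) (n : ℕ) (z : X) : L (φ^[n] z) = L z + n := by
  induction n with
  | zero => simp
  | succ n ih => rw [Function.iterate_succ_apply', hL, ih]; push_cast; ring

/-- A self-map of `ℍ` that is linearised to `w ↦ w + 1` by a continuous function admits no
canonical semiconjugation to a self-map of the disc that fixes the origin: the invariant function
`exp (2πi L)` would descend to a zero-free continuous function on the disc, whose logarithm would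
be an invariant determination of `2πi L`. -/
theorem not_isCanonical_disc {φ : ℍ → ℍ} {τ : 𝔻 → 𝔻} {L : ℍ → ℂ} (hφ : Function.Surjective φ)
    (hτ : Function.Injective τ) (hτ0 : τ 0 = 0) (hLc : Continuous L)
    (hL : ∀ z, L (φ z) = L z + 1) {σ : ℍ → 𝔻} (hσ : σ ∈ discSolutions φ τ) :
    ¬ IsCanonical φ τ σ := fun hcan => by
  obtain ⟨hσ, hs⟩ := hσ
  have hsurj := hcan.surjective hφ hτ
  set f : ℍ → ℂ := fun z => σ z with hf
  set E : ℍ → ℂ := fun z => Complex.exp (2 * Real.pi * Complex.I * L z) with hE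
  have hEf {w z : ℍ} (h : f w = f z) : E w = E z := by
    obtain ⟨k, n, e⟩ := hcan.exists_iterate_eq (Complex.UnitDisc.coe_injective h)
    have h1 := congrArg L e
    rw [apply_iterate_of_add_one hL, apply_iterate_of_add_one hL] at h1
    -- Points in one fibre of `σ` lie in one grand orbit, where `L` varies by integers.
    refine Complex.exp_eq_exp_iff_exists_int.2 ⟨k - n, ?_⟩
    push_cast
    linear_combination (2 * Real.pi * Complex.I) * h1
  obtain ⟨z₀, hz₀⟩ := hsurj 0
  have hmem {w : ℂ} (hw : w ∈ Metric.ball (0 : ℂ) 1) : ∃ z, f z = w := by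
    obtain ⟨z, hz⟩ := hsurj (Complex.UnitDisc.mk w (mem_ball_zero_iff.1 hw))
    exact ⟨z, by simp [hf, hz]⟩
  have hopen : IsOpenMap f := by
    obtain ⟨z₁, hz₁⟩ := hmem (w := 1 / 2) (by simp; norm_num)
    refine IsAnalytic.isOpenMap hσ (a := z₀) (b := z₁) ?_
    rw [hz₁]
    simp [hf, hz₀]
  -- `E` is constant on the fibres of `f`, so the choice of preimage is immaterial. Openness of `f`
  -- then makes the descended function continuous.
  have hgf (z : ℍ) : E (Function.invFun f (f z)) = E z :=
    hEf (Function.invFun_eq ⟨z, rfl⟩)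
  have hgc : ContinuousOn (E ∘ Function.invFun f) (Metric.ball 0 1) := fun w hw => by
    obtain ⟨z, rfl⟩ := hmem hw
    have hEc : Tendsto E (𝓝 z) (𝓝 (E z)) := Continuous.tendsto (by fun_prop) z
    have h1 : Tendsto (E ∘ Function.invFun f) (map f (𝓝 z)) (𝓝 (E z)) :=
      tendsto_map'_iff.2 (by simpa only [Function.comp_def, hgf] using hEc)
    refine ContinuousAt.continuousWithinAt ?_
    rw [ContinuousAt, Function.comp_apply, hgf]
    exact h1.mono_left (hopen.nhds_le z)
  have hcontr : ContractibleSpace (Metric.ball (0 : ℂ) 1) :=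
    Metric.contractibleSpace_ball one_pos
  have hsc : IsSimplyConnected (Metric.ball (0 : ℂ) 1) :=
    SimplyConnectedSpace.ofContractible _
  obtain ⟨h, hhc, hh⟩ := Complex.exists_continuousOn_eqOn_exp_comp
    hsc Metric.isOpen_ball hgc
    (by rintro ⟨w, -, hw⟩; exact Complex.exp_ne_zero _ hw)
  have hball (z : ℍ) : f z ∈ Metric.ball (0 : ℂ) 1 := mem_ball_zero_iff.2 (σ z).norm_lt_one
  have hhf (z : ℍ) : Complex.exp (h (f z)) = E z := (hh (hball z)).trans (hgf z)
  have hcont : Continuous fun z => h (f z) := hhc.comp_continuous hσ.continuous hball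
  obtain ⟨m, hm⟩ := Complex.exp_eq_exp_iff_exists_int.1 (hhf z₀)
  -- Two continuous lifts of `E` through exp agree everywhere once they agree at `z₀`.
  have hlift : (fun z => h (f z)) =
      fun z => 2 * Real.pi * Complex.I * L z + m * (2 * Real.pi * Complex.I) := by
    refine Complex.isCoveringMap_exp.eq_of_comp_eq hcont (by fun_prop) ?_ z₀ hm
    funext z
    refine Subtype.ext ?_
    change Complex.exp (h (f z)) = Complex.exp (_ + _)
    rw [hhf, Complex.exp_periodic.int_mul m]
  -- The fibre over the fixed point 0 is invariant: h ∘ f does not change from `z₀` to `φ z₀`, while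
  -- 2πi L grows by 2πi.
  have hφf : f (φ z₀) = f z₀ := by
    simp only [hf]
    rw [hs.eq, hz₀, hτ0]
  have h1 := congrFun hlift (φ z₀)
  have h2 := congrFun hlift z₀
  simp only [hφf, hL] at h1 h2
  have h3 : (2 * Real.pi * Complex.I : ℂ) = 0 := by linear_combination h2 - h1
  exact Complex.two_pi_I_ne_zero h3

/-! ### Dilations and translations: iterates and displacement -/

theorem coe_dilation (c : {x : ℝ // 0 < x}) (z : ℍ) : (dilation c z : ℂ) = (c : ℝ) * z := by
  simp [dilation]

theorem im_dilation (c : {x : ℝ // 0 < x}) (z : ℍ) : (dilation c z).im = c * z.im :=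
  UpperHalfPlane.pos_real_im c z

theorem coe_translation (d : ℝ) (z : ℍ) : (translation d z : ℂ) = d + z :=
  UpperHalfPlane.coe_vadd d z

theorem im_translation (d : ℝ) (z : ℍ) : (translation d z).im = z.im :=
  UpperHalfPlane.vadd_im d z

theorem dilation_bijective (c : {x : ℝ // 0 < x}) : Function.Bijective (dilation c) :=
  MulAction.bijective c

theorem translation_bijective (d : ℝ) : Function.Bijective (translation d) :=
  AddAction.bijective d

theorem discRotation_injective (θ : ℝ) : Function.Injective (discRotation θ) :=
  MulAction.injective _

theorem discRotation_zero (θ : ℝ) : discRotation θ 0 = 0 :=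
  Complex.UnitDisc.coe_injective (by simp [discRotation])

theorem coe_iterate_dilation (c : {x : ℝ // 0 < x}) (n : ℕ) (z : ℍ) :
    ((dilation c)^[n] z : ℂ) = (c : ℝ) ^ n * z := by
  induction n with
  | zero => simp
  | succ n ih => rw [Function.iterate_succ_apply', coe_dilation, ih]; ring

theorem coe_iterate_translation (d : ℝ) (n : ℕ) (z : ℍ) :
    ((translation d)^[n] z : ℂ) = n * d + z := by
  induction n with
  | zero => simp
  | succ n ih => rw [Function.iterate_succ_apply', coe_translation, ih]; push_cast; ring

theorem eq_of_iterate_dilation_eq {c : {x : ℝ // 0 < x}} (hc : 1 < (c : ℝ)) (z : ℍ) (n k : ℕ)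
    (h : (dilation c)^[n] z = (dilation c)^[k] z) : n = k := by
  have h1 := congrArg UpperHalfPlane.coe h
  rw [coe_iterate_dilation, coe_iterate_dilation, mul_left_inj' z.ne_zero] at h1
  exact pow_right_injective₀ c.2 hc.ne' (by exact_mod_cast h1)

theorem eq_of_iterate_translation_eq {d : ℝ} (hd : d ≠ 0) (z : ℍ) (n k : ℕ)
    (h : (translation d)^[n] z = (translation d)^[k] z) : n = k := by
  have h1 := congrArg UpperHalfPlane.coe h
  rw [coe_iterate_translation, coe_iterate_translation, add_left_inj] at h1
  exact_mod_cast mul_right_cancel₀ (Complex.ofReal_ne_zero.2 hd) h1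

theorem cosh_dist_dilation (c : {x : ℝ // 0 < x}) (z : ℍ) :
    Real.cosh (dist z (dilation c z)) =
      1 + ((c : ℝ) - 1) ^ 2 * (z.re ^ 2 + z.im ^ 2) / (2 * c * z.im ^ 2) := by
  have h : dist (z : ℂ) (dilation c z) ^ 2 = ((c : ℝ) - 1) ^ 2 * (z.re ^ 2 + z.im ^ 2) := by
    rw [coe_dilation, Complex.dist_eq, Complex.sq_norm, Complex.normSq_apply]
    simp
    ring
  rw [UpperHalfPlane.cosh_dist, h, im_dilation]
  congr 2
  ring

theorem cosh_dist_translation (d : ℝ) (z : ℍ) :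
    Real.cosh (dist z (translation d z)) = 1 + d ^ 2 / (2 * z.im ^ 2) := by
  have h : dist (z : ℂ) (translation d z) ^ 2 = d ^ 2 := by
    rw [coe_translation, Complex.dist_eq, Complex.sq_norm, Complex.normSq_apply]
    simp
    ring
  rw [UpperHalfPlane.cosh_dist, h, im_translation]
  congr 2
  ring

theorem cosh_dist_dilation_I (c : {x : ℝ // 0 < x}) :
    Real.cosh (dist UpperHalfPlane.I (dilation c UpperHalfPlane.I)) =
      1 + ((c : ℝ) - 1) ^ 2 / (2 * c) := by
  simp [cosh_dist_dilation]

/-- The displacement involves z only through (Re z / Im z)², which vanishes on the imaginary axis,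
the axis of the dilation. -/
theorem le_cosh_dist_dilation (c : {x : ℝ // 0 < x}) (z : ℍ) :
    1 + ((c : ℝ) - 1) ^ 2 / (2 * c) ≤ Real.cosh (dist z (dilation c z)) := by
  rw [cosh_dist_dilation]
  have hc := c.2
  have hz := z.im_pos
  gcongr 1 + ?_
  rw [div_le_div_iff₀ (by positivity) (by positivity)]
  have : 0 ≤ ((c : ℝ) - 1) ^ 2 * z.re ^ 2 * (2 * c) := by positivity
  nlinarith

theorem cosh_dist_le {σ : ℍ → ℍ} (hσ : IsAnalytic fun z => (σ z : ℂ)) (z w : ℍ) :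
    Real.cosh (dist (σ z) (σ w)) ≤ Real.cosh (dist z w) :=
  Real.cosh_le_cosh.2 (by
    rw [abs_of_nonneg dist_nonneg, abs_of_nonneg dist_nonneg]
    exact dist_le_dist_of_isAnalytic hσ z w)

theorem isAnalytic_dilation (c : {x : ℝ // 0 < x}) : IsAnalytic fun z => (dilation c z : ℂ) :=
  isAnalytic_of_eqOn (g := fun w => (c : ℝ) * w) (fun w _ => by fun_prop) (coe_dilation c)

theorem isAnalytic_translation (d : ℝ) : IsAnalytic fun z => (translation d z : ℂ) :=
  isAnalytic_of_eqOn (g := fun w => d + w) (fun w _ => by fun_prop) (coe_translation d)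

theorem dilation_comm (c S : {x : ℝ // 0 < x}) :
    Function.Semiconj (dilation c) (dilation S) (dilation S) := fun z =>
  UpperHalfPlane.coe_injective (by simp only [coe_dilation]; ring)

theorem translation_comm (d t : ℝ) :
    Function.Semiconj (translation d) (translation t) (translation t) := fun z =>
  UpperHalfPlane.coe_injective (by simp only [coe_translation]; ring)

/-! ### Maps between dilations -/

theorem I_ne_dilation_I {S : {x : ℝ // 0 < x}} (hS : 1 < (S : ℝ)) :
    UpperHalfPlane.I ≠ dilation S UpperHalfPlane.I := fun h => by
  have := congrArg UpperHalfPlane.im h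
  rw [im_dilation] at this
  simp at this
  linarith

/-- A holomorphic self-map of `ℍ` commuting with a dilation is a dilation. -/
theorem exists_eq_dilation {S : {x : ℝ // 0 < x}} (hS : 1 < (S : ℝ)) {σ : ℍ → ℍ}
    (hσ : σ ∈ halfPlaneSolutions (dilation S) (dilation S)) :
    ∃ c : {x : ℝ // 0 < x}, σ = dilation c := by
  obtain ⟨hσ, hs⟩ := hσ
  -- At i the displacement is already minimal and `σ` cannot increase it, so σ(i) must lie on the
  -- imaginary axis.
  have hd := cosh_dist_le hσ UpperHalfPlane.I (dilation S UpperHalfPlane.I)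
  rw [hs.eq, cosh_dist_dilation_I, cosh_dist_dilation, add_le_add_iff_left] at hd
  set p := σ UpperHalfPlane.I with hp
  have hp0 := p.im_pos
  have hre : p.re = 0 := by
    rw [div_le_div_iff₀ (by positivity) (by positivity)] at hd
    have h0 : 0 < ((S : ℝ) - 1) ^ 2 * (2 * S) := by
      have : 0 < (S : ℝ) - 1 := by linarith
      positivity
    have h1 : ((S : ℝ) - 1) ^ 2 * (2 * S) * p.re ^ 2 ≤ 0 := by nlinarith
    exact pow_eq_zero_iff two_ne_zero |>.1
      (le_antisymm (nonpos_of_mul_nonpos_right h1 h0) (sq_nonneg _))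
  refine ⟨⟨p.im, hp0⟩, ?_⟩
  set c : {x : ℝ // 0 < x} := ⟨p.im, hp0⟩ with hc
  have hpc : p = dilation c UpperHalfPlane.I := by
    refine UpperHalfPlane.ext_re_im ?_ ?_
    · simp [dilation, hre]
    · simp [dilation, hc]
  have hinv (z : ℍ) : dilation c⁻¹ (dilation c z) = z := inv_smul_smul c z
  have hinv' (z : ℍ) : dilation c (dilation c⁻¹ z) = z := smul_inv_smul c z
  have han : IsAnalytic fun z => (dilation c⁻¹ (σ z) : ℂ) := by
    simp only [IsAnalytic, coe_dilation]
    exact analyticOnNhd_const.mul hσ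
  -- Rescaled to fix i, the map still commutes with the dilation and therefore fixes Si as well.
  have key := eq_self_of_two_fixed_points (σ := fun z => dilation c⁻¹ (σ z)) han
    (I_ne_dilation_I hS) (by rw [← hp, hpc, hinv])
    (by rw [hs.eq, ← hp, hpc, (dilation_comm c⁻¹ S).eq, hinv])
  funext z
  rw [← hinv' (σ z)]
  exact congrArg _ (key z)

theorem intUnits_cast_ne_zero (ε : ℤˣ) : ((ε : ℤ) : ℝ) ≠ 0 :=
  Int.cast_ne_zero.2 ε.ne_zero

theorem intUnits_cast_sq (ε : ℤˣ) : ((ε : ℤ) : ℝ) ^ 2 = 1 := by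
  rcases Int.units_eq_one_or ε with rfl | rfl <;> simp

theorem bijective_of_isCanonical_dilation {φ : ℍ → ℍ} (hφ : Function.Bijective φ)
    {T : {x : ℝ // 0 < x}} (hT : 1 < (T : ℝ)) {σ : ℍ → ℍ} (h : IsCanonical φ (dilation T) σ) :
    Function.Bijective σ :=
  ⟨h.injective hφ.1 (eq_of_iterate_dilation_eq hT), h.surjective hφ.2 (dilation_bijective T).1⟩

theorem bijective_of_isCanonical_translation {φ : ℍ → ℍ} (hφ : Function.Bijective φ)
    {d : ℝ} (hd : d ≠ 0) {σ : ℍ → ℍ} (h : IsCanonical φ (translation d) σ) :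
    Function.Bijective σ :=
  ⟨h.injective hφ.1 (eq_of_iterate_translation_eq hd),
    h.surjective hφ.2 (translation_bijective d).1⟩

theorem halfPlaneSolutions_dilation {S : {x : ℝ // 0 < x}} (hS : 1 < (S : ℝ)) :
    halfPlaneSolutions (dilation S) (dilation S) =
      {σ | ∃ c : {x : ℝ // 0 < x}, σ = dilation c} := by
  ext σ
  refine ⟨exists_eq_dilation hS, ?_⟩
  rintro ⟨c, rfl⟩
  exact ⟨isAnalytic_dilation c, dilation_comm c S⟩

/-- A holomorphic automorphism of `ℍ` can only conjugate two dilations if they agree. -/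
theorem eq_of_bijective_of_semiconj_dilation {S T : {x : ℝ // 0 < x}} (hS : 1 < (S : ℝ))
    (hT : 1 < (T : ℝ)) {σ : ℍ → ℍ} (hσ : σ ∈ halfPlaneSolutions (dilation S) (dilation T))
    (hbij : Function.Bijective σ) : S = T := by
  obtain ⟨hσ, hs⟩ := hσ
  have hdist (z : ℍ) : dist (σ z) (dilation T (σ z)) = dist z (dilation S z) := by
    rw [← hs.eq, dist_eq_dist_of_bijective hσ hbij]
  obtain ⟨z, hz⟩ := hbij.2 UpperHalfPlane.I
  have h1 := le_cosh_dist_dilation T (σ UpperHalfPlane.I)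
  rw [hdist, cosh_dist_dilation_I, add_le_add_iff_left] at h1
  have h2 := le_cosh_dist_dilation S z
  rw [← hdist, hz, cosh_dist_dilation_I, add_le_add_iff_left] at h2
  have hS0 := S.2
  have hT0 := T.2
  have h3 := le_antisymm h1 h2
  rw [div_eq_div_iff (by positivity) (by positivity)] at h3
  -- Equal minimal displacements mean S = T or S = 1/T; the latter is excluded by S, T > 1.
  have h4 : ((S : ℝ) - T) * (S * T - 1) = 0 := by linear_combination -h3 / 2
  have h5 : (S : ℝ) * T - 1 ≠ 0 := by nlinarith
  exact Subtype.ext (sub_eq_zero.1 ((mul_eq_zero.1 h4).resolve_right h5))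

theorem isCanonical_dilation_iff {S T : {x : ℝ // 0 < x}} (hS : 1 < (S : ℝ))
    (hT : 1 < (T : ℝ)) {σ : ℍ → ℍ} (hσ : σ ∈ halfPlaneSolutions (dilation S) (dilation T)) :
    IsCanonical (dilation S) (dilation T) σ ↔
      S = T ∧ ∃ c : {x : ℝ // 0 < x}, σ = dilation c := by
  constructor
  · intro h
    obtain rfl := eq_of_bijective_of_semiconj_dilation hS hT hσ
      (bijective_of_isCanonical_dilation (dilation_bijective S) hT h)
    exact ⟨rfl, exists_eq_dilation hS hσ⟩
  · rintro ⟨-, c, rfl⟩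
    exact isCanonical_of_bijective hσ.2 (dilation_bijective c)

/-! ### Maps between translations -/

theorem translations_ssubset_halfPlaneSolutions (t : ℝ) :
    {σ | ∃ d : ℝ, σ = translation d} ⊂ halfPlaneSolutions (translation t) (translation t) := by
  refine (ssubset_iff_of_subset ?_).2 ?_
  · rintro _ ⟨d, rfl⟩
    exact ⟨isAnalytic_translation d, translation_comm d t⟩
  · have him (z : ℍ) : 0 < ((z : ℂ) + Complex.I).im := by
      have := z.im_pos
      simp
      linarith
    -- z ↦ z + i commutes with every real translation but raises the imaginary part.
    refine ⟨fun z => ⟨z + Complex.I, him z⟩, ⟨?_, fun z => ?_⟩, ?_⟩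
    · exact isAnalytic_of_eqOn (g := fun w => w + Complex.I) (fun w _ => by fun_prop)
        fun z => rfl
    · refine UpperHalfPlane.coe_injective ?_
      simp only [coe_translation]
      ring
    · rintro ⟨d, hd⟩
      have h := congrArg UpperHalfPlane.im (congrFun hd UpperHalfPlane.I)
      rw [im_translation] at h
      simp [UpperHalfPlane.im] at h

/-- A holomorphic automorphism of `ℍ` that conjugates nontrivial translations of the same
length is itself a translation. -/
theorem exists_eq_translation {s t : ℝ} (hs0 : s ≠ 0) (hst : s ^ 2 = t ^ 2) {σ : ℍ → ℍ}
    (hσ : σ ∈ halfPlaneSolutions (translation s) (translation t))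
    (hbij : Function.Bijective σ) : ∃ d : ℝ, σ = translation d := by
  obtain ⟨hσ, hs⟩ := hσ
  have him (z : ℍ) : (σ z).im = z.im := by
    have h : Real.cosh (dist (σ z) (translation t (σ z))) =
        Real.cosh (dist z (translation s z)) := by
      rw [← hs.eq, dist_eq_dist_of_bijective hσ hbij]
    have h1 := z.im_pos
    have h2 := (σ z).im_pos
    rw [cosh_dist_translation, cosh_dist_translation, add_right_inj, hst,
      div_eq_div_iff (by positivity) (by positivity)] at h
    have h3 : z.im ^ 2 = (σ z).im ^ 2 :=
      mul_left_cancel₀ (mul_ne_zero two_ne_zero (hst ▸ pow_ne_zero 2 hs0)) (by linear_combination h)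
    exact ((sq_eq_sq₀ h1.le h2.le).1 h3).symm
  -- σ(w) - w is analytic with zero imaginary part, hence a real constant.
  obtain ⟨d, hd⟩ := AnalyticOnNhd.eq_const_add_im_mul_I_of_re_eq_const (c₀ := 0)
    (AnalyticOnNhd.sub hσ analyticOnNhd_id) (fun w hw => by
      have := him (UpperHalfPlane.ofComplex w)
      rw [UpperHalfPlane.ofComplex_apply_of_im_pos hw] at this
      simp [UpperHalfPlane.ofComplex_apply_of_im_pos hw, this]) isOpen_im_pos
    ⟨⟨Complex.I, by simp⟩, isPreconnected_im_pos⟩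
  refine ⟨d, funext fun z => UpperHalfPlane.coe_injective ?_⟩
  have := hd z z.im_pos
  simp only [Pi.sub_apply, UpperHalfPlane.ofComplex_apply, Complex.ofReal_zero, zero_mul,
    add_zero] at this
  rw [coe_translation]
  linear_combination this

theorem isCanonical_unitTranslation_iff {ε ε' : ℤˣ} {σ : ℍ → ℍ}
    (hσ : σ ∈ halfPlaneSolutions (unitTranslation ε) (unitTranslation ε')) :
    IsCanonical (unitTranslation ε) (unitTranslation ε') σ ↔
      ε = ε' ∧ ∃ d : ℝ, σ = translation d := by
  constructor
  · intro h
    obtain ⟨d, rfl⟩ := exists_eq_translation (intUnits_cast_ne_zero ε)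
      ((intUnits_cast_sq ε).trans (intUnits_cast_sq ε').symm) hσ
      (bijective_of_isCanonical_translation (translation_bijective _)
        (intUnits_cast_ne_zero ε') h)
    refine ⟨?_, d, rfl⟩
    have h1 := congrArg UpperHalfPlane.coe (hσ.2.eq UpperHalfPlane.I)
    simp only [unitTranslation, coe_translation] at h1
    have h2 : (((ε : ℤ) : ℝ) : ℂ) = ((ε' : ℤ) : ℝ) := by linear_combination h1
    exact Units.ext (by exact_mod_cast h2)
  · rintro ⟨-, d, rfl⟩
    exact isCanonical_of_bijective hσ.2 (translation_bijective d)

/-! ### Mixed types -/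

theorem exists_sq_div_lt (d : ℝ) {δ : ℝ} (hδ : 0 < δ) :
    ∃ r : ℝ, 0 < r ∧ d ^ 2 / (2 * r ^ 2) < δ := by
  have h : Tendsto (fun r : ℝ => d ^ 2 / (2 * r ^ 2)) atTop (𝓝 0) :=
    tendsto_const_nhds.div_atTop
      ((tendsto_pow_atTop two_ne_zero).const_mul_atTop (by norm_num))
  exact ((eventually_gt_atTop 0).and (h.eventually_lt_const hδ)).exists

/-- An isometry would match the displacement of the translation, arbitrarily small at great height,
with one bounded below. -/
theorem not_isCanonical_dilation_translation {S : {x : ℝ // 0 < x}} (hS : 1 < (S : ℝ)) {d : ℝ}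
    (hd : d ≠ 0) {σ : ℍ → ℍ} (hσ : σ ∈ halfPlaneSolutions (dilation S) (translation d)) :
    ¬ IsCanonical (dilation S) (translation d) σ := fun h => by
  have hbij := bijective_of_isCanonical_translation (dilation_bijective S) hd h
  obtain ⟨hσ, hs⟩ := hσ
  have hS0 := S.2
  have hS1 : 0 < (S : ℝ) - 1 := by linarith
  have hδ : 0 < ((S : ℝ) - 1) ^ 2 / (2 * S) := by positivity
  obtain ⟨r, hr0, hr⟩ := exists_sq_div_lt d hδ
  obtain ⟨z, hz⟩ := hbij.2 (dilation ⟨r, hr0⟩ UpperHalfPlane.I)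
  have h1 := le_cosh_dist_dilation S z
  rw [← dist_eq_dist_of_bijective hσ hbij, hs.eq, hz, cosh_dist_translation, im_dilation,
    UpperHalfPlane.I_im, mul_one, add_le_add_iff_left] at h1
  linarith

/-- Here contraction alone suffices: high up the source displacement falls below the minimum for the
target. -/
theorem halfPlaneSolutions_translation_dilation (d : ℝ) {T : {x : ℝ // 0 < x}}
    (hT : 1 < (T : ℝ)) : halfPlaneSolutions (translation d) (dilation T) = ∅ := by
  refine eq_empty_of_forall_notMem fun σ ⟨hσ, hs⟩ => ?_
  have hT0 := T.2
  have hT1 : 0 < (T : ℝ) - 1 := by linarith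
  have hδ : 0 < ((T : ℝ) - 1) ^ 2 / (2 * T) := by positivity
  obtain ⟨r, hr0, hr⟩ := exists_sq_div_lt d hδ
  set z := dilation ⟨r, hr0⟩ UpperHalfPlane.I with hz
  have h1 := (le_cosh_dist_dilation T (σ z)).trans (hs.eq z ▸ cosh_dist_le hσ z (translation d z))
  rw [cosh_dist_translation, hz, im_dilation, UpperHalfPlane.I_im, mul_one,
    add_le_add_iff_left] at h1
  linarith

theorem not_isCanonical_dilation_disc {S : {x : ℝ // 0 < x}} (hS : 1 < (S : ℝ)) (θ : ℝ)
    {σ : ℍ → 𝔻} (hσ : σ ∈ discSolutions (dilation S) (discRotation θ)) :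
    ¬ IsCanonical (dilation S) (discRotation θ) σ := by
  have hlog : (Real.log S : ℂ) ≠ 0 := Complex.ofReal_ne_zero.2 (Real.log_pos hS).ne'
  -- The logarithm to base S turns multiplication by S into adding 1.
  refine not_isCanonical_disc (L := fun z => Complex.log z / Real.log S)
    (dilation_bijective S).2 (discRotation_injective θ) (discRotation_zero θ) ?_ (fun z => ?_) hσ
  · exact (continuous_iff_continuousAt.2 fun z =>
      (continuousAt_clog (UpperHalfPlane.mem_slitPlane z)).comp
        UpperHalfPlane.continuous_coe.continuousAt).div_const _
  · rw [coe_dilation, Complex.log_ofReal_mul S.2 z.ne_zero, add_div, div_self hlog, add_comm]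

theorem not_isCanonical_translation_disc {d : ℝ} (hd : d ≠ 0) (θ : ℝ)
    {σ : ℍ → 𝔻} (hσ : σ ∈ discSolutions (translation d) (discRotation θ)) :
    ¬ IsCanonical (translation d) (discRotation θ) σ := by
  refine not_isCanonical_disc (L := fun z => (z : ℂ) / d)
    (translation_bijective d).2 (discRotation_injective θ) (discRotation_zero θ) (by fun_prop)
    (fun z => ?_) hσ
  rw [coe_translation, add_div, div_self (Complex.ofReal_ne_zero.2 hd), add_comm]

end GrandOrbits

theorem mainTheorem5 :
    -- hyperbolic to hyperbolic
    (∀ S : {x : ℝ // 0 < x}, 1 < (S : ℝ) →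
      GrandOrbits.halfPlaneSolutions (GrandOrbits.dilation S) (GrandOrbits.dilation S) =
        {σ | ∃ c : {x : ℝ // 0 < x}, σ = GrandOrbits.dilation c}) ∧
    (∀ S T : {x : ℝ // 0 < x}, 1 < (S : ℝ) → 1 < (T : ℝ) →
      ∀ σ ∈ GrandOrbits.halfPlaneSolutions (GrandOrbits.dilation S) (GrandOrbits.dilation T),
        GrandOrbits.IsCanonical (GrandOrbits.dilation S) (GrandOrbits.dilation T) σ ↔
          S = T ∧ ∃ c : {x : ℝ // 0 < x}, σ = GrandOrbits.dilation c) ∧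
    -- parabolic to parabolic
    (∀ ε : ℤˣ,
      {σ | ∃ d : ℝ, σ = GrandOrbits.translation d} ⊂
        GrandOrbits.halfPlaneSolutions (GrandOrbits.unitTranslation ε)
          (GrandOrbits.unitTranslation ε)) ∧
    (∀ ε ε' : ℤˣ,
      ∀ σ ∈ GrandOrbits.halfPlaneSolutions (GrandOrbits.unitTranslation ε)
          (GrandOrbits.unitTranslation ε'),
        GrandOrbits.IsCanonical (GrandOrbits.unitTranslation ε)
            (GrandOrbits.unitTranslation ε') σ ↔
          ε = ε' ∧ ∃ d : ℝ, σ = GrandOrbits.translation d) ∧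
    -- hyperbolic to parabolic
    (∀ S : {x : ℝ // 0 < x}, 1 < (S : ℝ) → ∀ ε : ℤˣ,
      ∀ σ ∈ GrandOrbits.halfPlaneSolutions (GrandOrbits.dilation S)
          (GrandOrbits.unitTranslation ε),
        ¬ GrandOrbits.IsCanonical (GrandOrbits.dilation S) (GrandOrbits.unitTranslation ε) σ) ∧
    -- parabolic to hyperbolic
    (∀ ε : ℤˣ, ∀ T : {x : ℝ // 0 < x}, 1 < (T : ℝ) →
      ∀ σ ∈ GrandOrbits.halfPlaneSolutions (GrandOrbits.unitTranslation ε)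
          (GrandOrbits.dilation T),
        ¬ GrandOrbits.IsCanonical (GrandOrbits.unitTranslation ε) (GrandOrbits.dilation T) σ) ∧
    -- hyperbolic to elliptic
    (∀ S : {x : ℝ // 0 < x}, 1 < (S : ℝ) → ∀ θ ∈ Set.Ico (0 : ℝ) (2 * Real.pi),
      ∀ σ ∈ GrandOrbits.discSolutions (GrandOrbits.dilation S) (GrandOrbits.discRotation θ),
        ¬ GrandOrbits.IsCanonical (GrandOrbits.dilation S) (GrandOrbits.discRotation θ) σ) ∧
    -- parabolic to elliptic
    (∀ ε : ℤˣ, ∀ θ ∈ Set.Ico (0 : ℝ) (2 * Real.pi),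
      ∀ σ ∈ GrandOrbits.discSolutions (GrandOrbits.unitTranslation ε) (GrandOrbits.discRotation θ),
        ¬ GrandOrbits.IsCanonical (GrandOrbits.unitTranslation ε)
          (GrandOrbits.discRotation θ) σ) := by

  open GrandOrbits in
  exact ⟨fun S hS => halfPlaneSolutions_dilation hS,
    fun S T hS hT σ hσ => isCanonical_dilation_iff hS hT hσ,
    fun ε => translations_ssubset_halfPlaneSolutions _,
    fun ε ε' σ hσ => isCanonical_unitTranslation_iff hσ,
    fun S hS ε σ hσ => not_isCanonical_dilation_translation hS (intUnits_cast_ne_zero ε) hσ,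
    fun ε T hT σ hσ =>
      absurd hσ (halfPlaneSolutions_translation_dilation _ hT ▸ Set.notMem_empty σ),
    fun S hS θ _ σ hσ => not_isCanonical_dilation_disc hS θ hσ,
    fun ε θ _ σ hσ => not_isCanonical_translation_disc (intUnits_cast_ne_zero ε) θ hσ⟩
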